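/- Let $(R,\mathfrak m,k)$ be a commutative Noetherian local ring. For $R$-modules $M,N$ with projective resolutions $P_M,P_N$, let $(P_M,P_N)$ be the complex of graded homomorphisms, which in cohomological degree $n\in\mathbb Z$ is $\prod_{i}\operatorname{Hom}_R((P_M)_i,(P_N)_{i-n})$, with differential $\partial(f)=\partial f-(-1)^{n}f\partial$ for $f$ of degree $n$; its cohomology is $\operatorname{Ext}_R^*(M,N)$. Let $(P_M,P_N)_b$ be the subcomplex of homogeneous maps with only finitely many non-zero components. The Vogel cohomology $\widetilde{\operatorname{Ext}}{}_R^n(M,N)$ is the $n$-th cohomology of $(P_M,P_N)/(P_M,P_N)_b$, and $\zeta^n(M,N)\colon\operatorname{Ext}_R^n(M,N)\to\widetilde{\operatorname{Ext}}{}_R^n(M,N)$ is the map induced by the projection onto the quotient complex. For a finitely generated $R$-module $M\neq 0$, the $\zeta$-dimension of $M$ is the infimum in $\mathbb N\cup\{\infty\}$ (where $\mathbb N=\{0,1,2,\dots\}$) of all $n\in\mathbb N$ such that $\zeta^n(M,k)$ is an epimorphism and $\zeta^i(M,k)$ is an isomorphism for all $i>n$; the $\zeta$-dimension of $0$ is $-\infty$.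 Let $\mathcal Z$ be the full subcategory of the category of $R$-modules whose objects are the zero module and the finitely generated $R$-modules of $\zeta$-dimension zero. Let $0\to E\to L\to M\to 0$ be an exact sequence of $R$-modules. 1. (Closure under extensions.) If $E,M\in\mathcal Z$, then $L\in\mathcal Z$. 2. (Closure under kernels of epimorphisms.) If $L,M\in\mathcal Z$, then $E\in\mathcal Z$. Moreover, every finitely generated projective $R$-module belongs to $\mathcal Z$. -/

import Mathlib

open CategoryTheory

universe u

noncomputable section

namespace Vogel

open CochainComplex.HomComplex

variable (R : Type u) [CommRing R]

section Complexes

variable (F G : CochainComplex (ModuleCat.{u} R) ℤ)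

/-- The complex `(F, G)` of `R`-modules: in degree `n` it is `∏ p, Hom_R(F^p, G^(p+n))`, and the
differential is `∂ f = ∂ ∘ f - (-1)^n f ∘ ∂`. (The same as `CochainComplex.HomComplex F G`, with the
`R`-module structure kept.) -/
def homComplex : CochainComplex (ModuleCat.{u} R) ℤ where
  X n := ModuleCat.of R (Cochain F G n)
  d n m := ModuleCat.ofHom (δ_hom R F G n m)
  shape n m h := ModuleCat.hom_ext (LinearMap.ext fun z => δ_shape n m h z)
  d_comp_d' n m l _ _ := ModuleCat.hom_ext (LinearMap.ext fun z => δ_δ n m l z)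

/-- The submodule `(F, G)_b` of bounded homogeneous maps of degree `n`: those with only finitely
many non-zero components. -/
def boundedCochains (n : ℤ) : Submodule R (Cochain F G n) where
  carrier := {f | {p : ℤ | f.v p (p + n) rfl ≠ 0}.Finite}
  zero_mem' := by simp
  add_mem' {f g} hf hg := by
    refine (Set.Finite.union hf hg).subset fun p hp => ?_
    by_contra h
    simp only [Set.mem_union, Set.mem_ofPred_eq, not_or, not_not] at h
    exact hp (by simp [h.1, h.2])
  smul_mem' r f hf := by
    refine Set.Finite.subset hf fun p hp h => hp ?_
    simp [h]

/-- The differential maps bounded maps to bounded maps. -/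
lemma boundedCochains_le_comap (n m : ℤ) :
    boundedCochains R F G n ≤ (boundedCochains R F G m).comap (δ_hom R F G n m) := by
  intro f hf
  by_cases hnm : n + 1 = m
  · refine (Set.Finite.union hf (Set.Finite.image (fun p : ℤ => p - 1) hf)).subset fun p hp => ?_
    by_contra h
    simp only [Set.mem_union, Set.mem_ofPred_eq, not_or, not_not, Set.mem_image, not_exists,
      not_and] at h
    obtain ⟨h₁, h₂⟩ := h
    have h₃ : f.v (p + 1) (p + 1 + n) rfl = 0 := by
      by_contra h₃
      exact h₂ (p + 1) h₃ (by simp)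
    refine hp ?_
    change (δ n m f).v p (p + m) rfl = 0
    rw [δ_v n m hnm f p (p + m) rfl (p + n) (p + 1) (by lia) rfl]
    have h₄ : ∀ q (hq : p + 1 + n = q), f.v (p + 1) q hq = 0 := by
      rintro q rfl
      exact h₃
    simp [h₁, h₄]
  · change δ n m f ∈ boundedCochains R F G m
    rw [δ_shape n m hnm f]
    exact Submodule.zero_mem _

/-- The quotient complex `(F, G) / (F, G)_b`. -/
def vogelComplex : CochainComplex (ModuleCat.{u} R) ℤ where
  X n := ModuleCat.of R (Cochain F G n ⧸ boundedCochains R F G n)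
  d n m := ModuleCat.ofHom
    ((boundedCochains R F G n).mapQ (boundedCochains R F G m) (δ_hom R F G n m)
      (boundedCochains_le_comap R F G n m))
  shape n m h := by
    refine ModuleCat.hom_ext (LinearMap.ext fun z => ?_)
    obtain ⟨z, rfl⟩ := Submodule.mkQ_surjective _ z
    exact congrArg (boundedCochains R F G m).mkQ (δ_shape n m h z)
  d_comp_d' n m l _ _ := by
    refine ModuleCat.hom_ext (LinearMap.ext fun z => ?_)
    obtain ⟨z, rfl⟩ := Submodule.mkQ_surjective _ z
    exact congrArg (boundedCochains R F G l).mkQ (δ_δ n m l z)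

/-- The canonical projection `(F, G) ⟶ (F, G) / (F, G)_b`. -/
def toVogelComplex : homComplex R F G ⟶ vogelComplex R F G where
  f n := ModuleCat.ofHom (boundedCochains R F G n).mkQ
  comm' _ _ _ := rfl

end Complexes

variable {R}

/-- A projective resolution `P_M` of `M`, as a complex indexed by `ℤ` with cohomological grading
(so `P_i` sits in degree `-i`). -/
def resolution (M : ModuleCat.{u} R) : CochainComplex (ModuleCat.{u} R) ℤ :=
  (projectiveResolution M).cochainComplex

/-- `Ext_R^n(M, N)`, as the cohomology of `(P_M, P_N)`. -/
def ext (M N : ModuleCat.{u} R) (n : ℤ) : ModuleCat.{u} R :=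
  (homComplex R (resolution M) (resolution N)).homology n

/-- Vogel cohomology of the pair `(M, N)` in degree `n`: the cohomology of
`(P_M, P_N) / (P_M, P_N)_b`. -/
def vogelExt (M N : ModuleCat.{u} R) (n : ℤ) : ModuleCat.{u} R :=
  (vogelComplex R (resolution M) (resolution N)).homology n

/-- The comparison map `ζ^n(M, N)` from `Ext_R^n(M, N)` to Vogel cohomology. -/
def zeta (M N : ModuleCat.{u} R) (n : ℤ) : ext M N n ⟶ vogelExt M N n :=
  HomologicalComplex.homologyMap (toVogelComplex R (resolution M) (resolution N)) n

variable (R) in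
/-- The residue field `k` of `R`, as an `R`-module. -/
def residueModule [IsLocalRing R] : ModuleCat.{u} R :=
  ModuleCat.of R (IsLocalRing.ResidueField R)

open Classical in
/-- The `ζ`-dimension of `M`: `-∞` if `M = 0`, and otherwise the infimum in `ℕ ∪ {∞}` of the `n`
such that `ζ^n(M, k)` is an epimorphism and `ζ^i(M, k)` is an isomorphism for all `i > n`. -/
def zetaDim [IsLocalRing R] (M : ModuleCat.{u} R) : WithBot ℕ∞ :=
  if Subsingleton M then ⊥
  else ((⨅ (n : ℕ) (_ : Epi (zeta M (residueModule R) n) ∧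
    ∀ i : ℤ, (n : ℤ) < i → IsIso (zeta M (residueModule R) i)), (n : ℕ∞) : ℕ∞) : WithBot ℕ∞)

variable (R) in
/-- The full subcategory `𝒵`: the finitely generated modules of `ζ`-dimension zero, together with
the zero module. -/
def zetaZero [IsLocalRing R] : ObjectProperty (ModuleCat.{u} R) := fun M =>
  Module.Finite R M ∧ (Subsingleton M ∨ zetaDim M = 0)

end Vogel

end

/-!
The long exact cohomology sequence of `0 → (F, G)_b → (F, G) → (F, G) / (F, G)_b → 0` shows that the
`ζ`-dimension condition in degree `n` says that the cohomology of `(P_M, P_N)_b` vanishes in degrees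
`i > n`. This cohomology only depends on the homotopy type of `P_M`. For a short exact sequence
`0 → E → L → M → 0`, the complex `P_M` is homotopy equivalent to the mapping cone of a lift
`P_E ⟶ P_L`, and a bounded cochain on the cone is a pair of bounded cochains on `P_E` and `P_L`, so
vanishing for `M` and for one of `E`, `L` gives vanishing for the other. For `P` projective, `P_P`
may be replaced by `P` in degree zero, which has no nonzero cochains of positive degree to `P_N`.
-/

universe v

namespace Vogel

open CochainComplex CochainComplex.HomComplex

section BoundedCochains

variable {R : Type u} [CommRing R] {F F' G K : CochainComplex (ModuleCat.{u} R) ℤ}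

lemma comp_mem_boundedCochains {n₁ n₂ n₁₂ : ℤ} (f : Cochain F G n₁) {g : Cochain G K n₂}
    (hg : g ∈ boundedCochains R G K n₂) (h : n₁ + n₂ = n₁₂) :
    f.comp g h ∈ boundedCochains R F K n₁₂ := by
  refine (Set.Finite.image (fun p : ℤ => p - n₁) hg).subset fun p hp => ?_
  refine ⟨p + n₁, fun hzero => hp ?_, by simp⟩
  have hzero' : ∀ q (hq : p + n₁ + n₂ = q), g.v (p + n₁) q hq = 0 := by
    rintro q rfl
    exact hzero
  rw [Cochain.comp_v f g h p (p + n₁) _ rfl (by lia), hzero', Limits.comp_zero]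

lemma units_smul_mem_boundedCochains {n : ℤ} (ε : ℤˣ) {f : Cochain F G n}
    (hf : f ∈ boundedCochains R F G n) : ε • f ∈ boundedCochains R F G n :=
  zsmul_mem hf (ε : ℤ)

variable (R F G) in
/-- The complex `(F, G)_b` of bounded homogeneous maps, a subcomplex of `homComplex R F G`. -/
def boundedComplex : CochainComplex (ModuleCat.{u} R) ℤ where
  X n := ModuleCat.of R (boundedCochains R F G n)
  d n m := ModuleCat.ofHom
    ((δ_hom R F G n m).restrict (boundedCochains_le_comap R F G n m))
  shape n m h := ModuleCat.hom_ext (LinearMap.ext fun z => Subtype.ext (δ_shape n m h z.1))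
  d_comp_d' n m l _ _ := ModuleCat.hom_ext (LinearMap.ext fun z => Subtype.ext (δ_δ n m l z.1))

lemma boundedComplex_exactAt_iff (m n l : ℤ) (hmn : m + 1 = n) (hnl : n + 1 = l) :
    (boundedComplex R F G).ExactAt n ↔
      ∀ f ∈ boundedCochains R F G n, δ n l f = 0 → ∃ g ∈ boundedCochains R F G m, δ m n g = f := by
  rw [HomologicalComplex.exactAt_iff' _ m n l (by simp; lia) (by simpa),
    ShortComplex.moduleCat_exact_iff]
  constructor
  · intro h f hf hδ
    obtain ⟨g, hg⟩ := h ⟨f, hf⟩ (Subtype.ext hδ)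
    exact ⟨g.1, g.2, congrArg Subtype.val hg⟩
  · rintro h ⟨f, hf⟩ hδ
    obtain ⟨g, hg, hgf⟩ := h f hf (congrArg Subtype.val hδ)
    exact ⟨⟨g, hg⟩, Subtype.ext hgf⟩

lemma boundedComplex_exactAt_of_homotopy {n : ℤ} (s : F' ⟶ F) (π : F ⟶ F')
    (η : Homotopy (𝟙 F') (s ≫ π)) (hF : (boundedComplex R F G).ExactAt n) :
    (boundedComplex R F' G).ExactAt n := by
  have hn : n - 1 + 1 = n := sub_add_cancel n 1
  rw [boundedComplex_exactAt_iff (n - 1) n _ hn rfl] at hF ⊢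
  intro f hf hδ
  obtain ⟨g, hg, hgf⟩ := hF ((Cochain.ofHom π).comp f (zero_add n))
    (comp_mem_boundedCochains _ hf _) (by simp [hδ])
  -- If `π f = δ g`, then `f = (f - s π f) + δ (s g)`, and `f - s π f` is `± δ (η f)`.
  refine ⟨(Cochain.ofHom s).comp g (zero_add _) +
      n.negOnePow • (Cochain.ofHomotopy η).comp f (by lia),
    add_mem (comp_mem_boundedCochains _ hg _)
      (units_smul_mem_boundedCochains _ (comp_mem_boundedCochains _ hf _)), ?_⟩
  rw [δ_add, δ_ofHom_comp, hgf, δ_units_smul,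
    δ_comp (Cochain.ofHomotopy η) f _ 0 (n + 1) n hn (by lia) rfl, hδ]
  simp [smul_smul, Cochain.sub_comp, Cochain.ofHom_comp]

lemma boundedComplex_exactAt_of_homotopyEquiv {n : ℤ} (e : HomotopyEquiv F F')
    (hF : (boundedComplex R F G).ExactAt n) : (boundedComplex R F' G).ExactAt n :=
  boundedComplex_exactAt_of_homotopy e.inv e.hom e.homotopyInvHomId.symm hF

lemma boundedComplex_exactAt_of_isStrictlyGE_of_isStrictlyLE (a b : ℤ) [F.IsStrictlyGE a]
    [G.IsStrictlyLE b] {n : ℤ} (hn : b < a + n) : (boundedComplex R F G).ExactAt n := by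
  rw [boundedComplex_exactAt_iff (n - 1) n _ (by lia) rfl]
  intro f _ _
  refine ⟨0, zero_mem _, ?_⟩
  rw [δ_zero]
  ext p q hpq : 1
  obtain hp | hp := lt_or_ge p a
  · exact (F.isZero_of_isStrictlyGE a p hp).eq_of_src _ _
  · exact (G.isZero_of_isStrictlyLE b q (by lia)).eq_of_tgt _ _

variable {E L : CochainComplex (ModuleCat.{u} R) ℤ} (ψ : E ⟶ L) {n : ℤ}

lemma boundedComplex_exactAt_target_of_mappingCone (hE : (boundedComplex R E G).ExactAt n)
    (hcone : (boundedComplex R (mappingCone ψ) G).ExactAt n) :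
    (boundedComplex R L G).ExactAt n := by
  have hn : n - 1 + 1 = n := sub_add_cancel n 1
  rw [boundedComplex_exactAt_iff (n - 1) n _ hn rfl] at hE hcone ⊢
  intro f hf hδ
  -- A primitive `g` of `± ψ f` extends the cocycle `f` on `L` to a cocycle `(g, f)` on the cone.
  obtain ⟨g, hg, hgf⟩ := hE (n.negOnePow • (Cochain.ofHom ψ).comp f (zero_add n))
    (units_smul_mem_boundedCochains _ (comp_mem_boundedCochains _ hf _)) (by simp [hδ])
  obtain ⟨h, hh, hhf⟩ := hcone (mappingCone.descCochain ψ g f hn)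
    (add_mem (comp_mem_boundedCochains _ hg _) (comp_mem_boundedCochains _ hf _))
    (by simp [mappingCone.δ_descCochain _ _ _ _ _ rfl, hgf, hδ, Int.negOnePow_succ])
  exact ⟨(Cochain.ofHom (mappingCone.inr ψ)).comp h (zero_add _),
    comp_mem_boundedCochains _ hh _, by simp [hhf]⟩

lemma boundedComplex_exactAt_source_of_mappingCone (hL : (boundedComplex R L G).ExactAt n)
    (hcone : (boundedComplex R (mappingCone ψ) G).ExactAt (n + 1)) :
    (boundedComplex R E G).ExactAt n := by
  have hn : n - 1 + 1 = n := sub_add_cancel n 1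
  rw [boundedComplex_exactAt_iff (n - 1) n _ hn rfl] at hL ⊢
  rw [boundedComplex_exactAt_iff n (n + 1) _ rfl rfl] at hcone
  intro f hf hδ
  -- A primitive `h` of the cocycle `(f, 0)` on the cone restricts to a cocycle on `L`; correcting
  -- the restriction of `h` to `E` by a primitive `g` of that cocycle gives a primitive of `f`.
  obtain ⟨h, hh, hhf⟩ := hcone ((mappingCone.fst ψ).1.comp f (add_comm 1 n))
    (comp_mem_boundedCochains _ hf _)
    (by simp [δ_comp (mappingCone.fst ψ).1 f (add_comm 1 n) 2 (n + 1) (n + 1 + 1) rfl rfl rfl, hδ])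
  obtain ⟨g, hg, hgf⟩ := hL ((Cochain.ofHom (mappingCone.inr ψ)).comp h (zero_add n))
    (comp_mem_boundedCochains _ hh _) (by simp [hhf])
  refine ⟨(mappingCone.inl ψ).comp h (by lia) -
      n.negOnePow • (Cochain.ofHom ψ).comp g (zero_add _),
    sub_mem (comp_mem_boundedCochains _ hh _)
      (units_smul_mem_boundedCochains _ (comp_mem_boundedCochains _ hg _)), ?_⟩
  rw [δ_sub, δ_units_smul, δ_ofHom_comp, hgf,
    δ_comp (mappingCone.inl ψ) h _ 0 (n + 1) n hn (by lia) rfl, hhf]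
  simp [Cochain.ofHom_comp]

end BoundedCochains

section Comparison

lemma shortExact_exactAt_X₁_iff {C ι : Type*} [Category* C] [Abelian C] {c : ComplexShape ι}
    {S : ShortComplex (HomologicalComplex C c)} (hS : S.ShortExact) {i j : ι} (hij : c.Rel i j) :
    S.X₁.ExactAt j ↔ Epi (HomologicalComplex.homologyMap S.g i) ∧
      Mono (HomologicalComplex.homologyMap S.g j) := by
  rw [HomologicalComplex.exactAt_iff_isZero_homology, (hS.homology_exact₁ i j hij).isZero_X₂_iff,
    (hS.homology_exact₃ i j hij).epi_f_iff, (hS.homology_exact₂ j).mono_g_iff]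

variable (R : Type u) [CommRing R] (F G : CochainComplex (ModuleCat.{u} R) ℤ)

/-- The short complex `(F, G)_b ⟶ (F, G) ⟶ (F, G) / (F, G)_b`. -/
def vogelShortComplex : ShortComplex (CochainComplex (ModuleCat.{u} R) ℤ) where
  X₁ := boundedComplex R F G
  f := { f n := ModuleCat.ofHom (boundedCochains R F G n).subtype }
  g := toVogelComplex R F G
  zero := by
    ext n x
    exact (Submodule.Quotient.mk_eq_zero _).2 x.2

lemma vogelShortComplex_shortExact : (vogelShortComplex R F G).ShortExact :=
  HomologicalComplex.shortExact_of_degreewise_shortExact _ fun n =>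
    ModuleCat.shortComplex_shortExact _ (LinearMap.exact_subtype_mkQ (boundedCochains R F G n))
      Subtype.val_injective (Submodule.mkQ_surjective _)

lemma epi_and_isIso_homologyMap_toVogelComplex_iff (n : ℤ) :
    (Epi (HomologicalComplex.homologyMap (toVogelComplex R F G) n) ∧
      ∀ i : ℤ, n < i → IsIso (HomologicalComplex.homologyMap (toVogelComplex R F G) i)) ↔
      ∀ i : ℤ, n < i → (boundedComplex R F G).ExactAt i := by
  have exactAt_iff (i : ℤ) : (boundedComplex R F G).ExactAt (i + 1) ↔
      Epi (HomologicalComplex.homologyMap (toVogelComplex R F G) i) ∧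
        Mono (HomologicalComplex.homologyMap (toVogelComplex R F G) (i + 1)) :=
    shortExact_exactAt_X₁_iff (vogelShortComplex_shortExact R F G) rfl
  constructor
  · rintro ⟨hepi, hiso⟩ i hi
    obtain ⟨i, rfl⟩ : ∃ j, i = j + 1 := ⟨i - 1, by lia⟩
    have := hiso (i + 1) hi
    refine (exactAt_iff i).2 ⟨?_, inferInstance⟩
    obtain rfl | hi := (Int.lt_add_one_iff.1 hi).eq_or_lt
    · exact hepi
    · have := hiso i hi
      infer_instance
  · intro h
    refine ⟨((exactAt_iff n).1 (h _ (by lia))).1, fun i hi => ?_⟩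
    obtain ⟨i, rfl⟩ : ∃ j, i = j + 1 := ⟨i - 1, by lia⟩
    have := ((exactAt_iff i).1 (h _ hi)).2
    have := ((exactAt_iff (i + 1)).1 (h _ (by lia))).1
    exact isIso_of_mono_of_epi _

end Comparison

section KProjective

open DerivedCategory Pretriangulated

variable {C : Type u} [Category.{v} C] [Abelian C]

instance isKProjective_mappingCone {K L : CochainComplex C ℤ} [K.IsKProjective] [L.IsKProjective]
    (f : K ⟶ L) : (mappingCone f).IsKProjective :=
  (isKProjective_iff_leftOrthogonal _).2 <|
    ObjectProperty.ext_of_isTriangulatedClosed₃ _ _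
      (HomotopyCategory.mappingCone_triangleh_distinguished f)
      (IsKProjective.leftOrthogonal K) (IsKProjective.leftOrthogonal L)

lemma nonempty_homotopyEquiv_of_quasiIso {K L : CochainComplex C ℤ} [K.IsKProjective]
    [L.IsKProjective] (f : K ⟶ L) [QuasiIso f] : Nonempty (HomotopyEquiv K L) :=
  ⟨((IsKProjective.quasiIso_iff f).1 inferInstance).choose⟩

lemma Q_map_surjective_of_isKProjective [HasDerivedCategory C] (K L : CochainComplex C ℤ)
    [K.IsKProjective] : Function.Surjective (Q.map : (K ⟶ L) → _) := by
  intro g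
  obtain ⟨f, hf⟩ := (IsKProjective.Qh_map_bijective K _).surjective
    ((quotientCompQhIso C).hom.app K ≫ g ≫ (quotientCompQhIso C).inv.app L)
  obtain ⟨f, rfl⟩ := (HomotopyCategory.quotient _ _).map_surjective f
  refine ⟨f, ?_⟩
  rw [← cancel_epi ((quotientCompQhIso C).hom.app K), ← quotientCompQhIso_hom_naturality, hf]
  simp

/-- The augmentation of a projective resolution, as an isomorphism in the derived category. -/
noncomputable def augmentationIso [HasDerivedCategory C] {X : C} (P : ProjectiveResolution X) :
    Q.obj P.cochainComplex ≅ (DerivedCategory.singleFunctor C 0).obj X :=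
  have : IsIso (Q.map P.π') := (isIso_Q_map_iff_quasiIso _ _).2 inferInstance
  asIso (Q.map P.π') ≪≫ ((singleFunctorIsoCompQ C 0).app X).symm

lemma exists_homotopyEquiv_mappingCone {S : ShortComplex C} (hS : S.ShortExact)
    (P₁ : ProjectiveResolution S.X₁) (P₂ : ProjectiveResolution S.X₂)
    (P₃ : ProjectiveResolution S.X₃) :
    ∃ ψ : P₁.cochainComplex ⟶ P₂.cochainComplex,
      Nonempty (HomotopyEquiv (mappingCone ψ) P₃.cochainComplex) := by
  let := HasDerivedCategory.standard C
  obtain ⟨ψ, hψ⟩ := Q_map_surjective_of_isKProjective _ _ ((augmentationIso P₁).hom ≫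
    (DerivedCategory.singleFunctor C 0).map S.f ≫ (augmentationIso P₂).inv)
  have hcomm : Q.map ψ ≫ (augmentationIso P₂).hom =
      (augmentationIso P₁).hom ≫ (DerivedCategory.singleFunctor C 0).map S.f := by
    simp [hψ]
  let e := isoTriangleOfIso₁₂ _ _ (mappingCone_triangle_distinguished ψ)
    hS.singleTriangle_distinguished (augmentationIso P₁) (augmentationIso P₂) hcomm
  let e₃ : Q.obj (mappingCone ψ) ≅ Q.obj P₃.cochainComplex :=
    Triangle.π₃.mapIso e ≪≫ (augmentationIso P₃).symm
  obtain ⟨φ, hφ⟩ := Q_map_surjective_of_isKProjective _ _ e₃.hom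
  have : QuasiIso φ := (isIso_Q_map_iff_quasiIso _ _).1 (hφ ▸ inferInstance)
  exact ⟨ψ, nonempty_homotopyEquiv_of_quasiIso φ⟩

lemma nonempty_homotopyEquiv_single {X : C} [Projective X] (P : ProjectiveResolution X) :
    Nonempty (HomotopyEquiv P.cochainComplex ((CochainComplex.singleFunctor C 0).obj X)) := by
  have (n : ℤ) : Projective (((CochainComplex.singleFunctor C 0).obj X).X n) :=
    inferInstanceAs (Projective (((HomologicalComplex.single C (.up ℤ) 0).obj X).X n))
  have : ((CochainComplex.singleFunctor C 0).obj X).IsKProjective := isKProjective_of_projective _ 0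
  exact nonempty_homotopyEquiv_of_quasiIso P.π'

end KProjective

section ZetaDimension

variable {R : Type u} [CommRing R]

/-- The modules of `ζ`-dimension at most `n` relative to a coefficient module `N`: `ζ^n(M, N)` is an
epimorphism and `ζ^i(M, N)` is an isomorphism for `i > n`. Unlike in `zetaDim`, the module `N` need
not be a residue field, and no exception is made for the zero module. -/
def zetaDimLE (N : ModuleCat.{u} R) (n : ℤ) : ObjectProperty (ModuleCat.{u} R) := fun M =>
  Epi (zeta M N n) ∧ ∀ i : ℤ, n < i → IsIso (zeta M N i)

variable {N : ModuleCat.{u} R} {n : ℤ}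

lemma zetaDimLE_iff {M : ModuleCat.{u} R} :
    zetaDimLE N n M ↔
      ∀ i : ℤ, n < i → (boundedComplex R (resolution M) (resolution N)).ExactAt i :=
  epi_and_isIso_homologyMap_toVogelComplex_iff R (resolution M) (resolution N) n

variable (N) in
lemma zetaDimLE_monotone : Monotone (zetaDimLE N) := fun _ _ hmn _ hM =>
  zetaDimLE_iff.2 fun i hi => zetaDimLE_iff.1 hM i (hmn.trans_lt hi)

lemma zetaDimLE_X₂ {S : ShortComplex (ModuleCat.{u} R)} (hS : S.ShortExact)
    (h₁ : zetaDimLE N n S.X₁) (h₃ : zetaDimLE N n S.X₃) : zetaDimLE N n S.X₂ := by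
  rw [zetaDimLE_iff] at h₁ h₃ ⊢
  obtain ⟨ψ, ⟨e⟩⟩ := exists_homotopyEquiv_mappingCone hS (projectiveResolution S.X₁)
    (projectiveResolution S.X₂) (projectiveResolution S.X₃)
  exact fun i hi => boundedComplex_exactAt_target_of_mappingCone ψ (h₁ i hi)
    (boundedComplex_exactAt_of_homotopyEquiv e.symm (h₃ i hi))

lemma zetaDimLE_X₁ {S : ShortComplex (ModuleCat.{u} R)} (hS : S.ShortExact)
    (h₂ : zetaDimLE N n S.X₂) (h₃ : zetaDimLE N (n + 1) S.X₃) : zetaDimLE N n S.X₁ := by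
  rw [zetaDimLE_iff] at h₂ h₃ ⊢
  obtain ⟨ψ, ⟨e⟩⟩ := exists_homotopyEquiv_mappingCone hS (projectiveResolution S.X₁)
    (projectiveResolution S.X₂) (projectiveResolution S.X₃)
  exact fun i hi => boundedComplex_exactAt_source_of_mappingCone ψ (h₂ i hi)
    (boundedComplex_exactAt_of_homotopyEquiv e.symm (h₃ (i + 1) (by lia)))

lemma zetaDimLE_of_projective (hn : 0 ≤ n) (P : ModuleCat.{u} R) [Projective P] :
    zetaDimLE N n P := by
  obtain ⟨e⟩ := nonempty_homotopyEquiv_single (projectiveResolution P)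
  have : (resolution N).IsStrictlyLE 0 :=
    inferInstanceAs ((projectiveResolution N).cochainComplex.IsStrictlyLE 0)
  exact zetaDimLE_iff.2 fun i hi => boundedComplex_exactAt_of_homotopyEquiv e.symm
    (boundedComplex_exactAt_of_isStrictlyGE_of_isStrictlyLE 0 0 (by lia))

lemma zetaDim_le_iff [IsLocalRing R] (M : ModuleCat.{u} R) (n : ℕ) :
    zetaDim M ≤ n ↔ zetaDimLE (residueModule R) n M := by
  obtain hM | hM := subsingleton_or_nontrivial M
  · have : Projective M := (ModuleCat.isZero_of_subsingleton M).projective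
    simp [zetaDim, hM, zetaDimLE_of_projective]
  rw [zetaDim, if_neg (not_subsingleton M)]
  refine WithBot.coe_le_coe.trans ?_
  rw [← ENat.lt_add_one_iff (ENat.natCast_ne_top n)]
  simp only [iInf_lt_iff]
  constructor
  · rintro ⟨m, hm, hmn⟩
    have hmn' : m ≤ n := by exact_mod_cast (ENat.lt_add_one_iff (ENat.natCast_ne_top n)).1 hmn
    exact zetaDimLE_monotone _ (Int.ofNat_le.2 hmn') _ hm
  · exact fun h => ⟨n, h, (ENat.lt_add_one_iff (ENat.natCast_ne_top n)).2 le_rfl⟩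

lemma zetaZero_iff [IsLocalRing R] (M : ModuleCat.{u} R) :
    zetaZero R M ↔ Module.Finite R M ∧ zetaDimLE (residueModule R) 0 M := by
  refine and_congr_right fun _ => Iff.trans ?_ (zetaDim_le_iff M 0)
  by_cases hM : Subsingleton M <;> simp [zetaDim, hM]

end ZetaDimension

end Vogel

open Vogel in
theorem proposition1p10_general {R : Type u} [CommRing R] (N : ModuleCat.{u} R) (n : ℤ) :
    (∀ S : ShortComplex (ModuleCat.{u} R), S.ShortExact →
      zetaDimLE N n S.X₁ → zetaDimLE N n S.X₃ → zetaDimLE N n S.X₂) ∧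
    (∀ S : ShortComplex (ModuleCat.{u} R), S.ShortExact →
      zetaDimLE N n S.X₂ → zetaDimLE N (n + 1) S.X₃ → zetaDimLE N n S.X₁) ∧
    (0 ≤ n → ∀ P : ModuleCat.{u} R, Module.Projective R P → zetaDimLE N n P) :=
  ⟨fun _ => zetaDimLE_X₂, fun _ => zetaDimLE_X₁, fun hn P _ => zetaDimLE_of_projective hn P⟩

theorem proposition1p10 {R : Type u} [CommRing R] [IsNoetherianRing R] [IsLocalRing R] :
    (∀ S : ShortComplex (ModuleCat.{u} R), S.ShortExact →
      Vogel.zetaZero R S.X₁ → Vogel.zetaZero R S.X₃ → Vogel.zetaZero R S.X₂) ∧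
    (∀ S : ShortComplex (ModuleCat.{u} R), S.ShortExact →
      Vogel.zetaZero R S.X₂ → Vogel.zetaZero R S.X₃ → Vogel.zetaZero R S.X₁) ∧
    (∀ P : ModuleCat.{u} R, Module.Finite R P → Module.Projective R P →
      Vogel.zetaZero R P) := by
  simp only [Vogel.zetaZero_iff]
  obtain ⟨extension, kernel, projective⟩ := proposition1p10_general (Vogel.residueModule R) 0
  refine ⟨fun S hS ⟨_, h₁⟩ ⟨_, h₃⟩ => ⟨?_, extension S hS h₁ h₃⟩,
    fun S hS ⟨_, h₂⟩ ⟨_, h₃⟩ => ⟨Module.Finite.of_injective S.f.hom hS.moduleCat_injective_f,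
      kernel S hS h₂ (Vogel.zetaDimLE_monotone _ (by lia) _ h₃)⟩,
    fun P hP hproj => ⟨hP, projective le_rfl P hproj⟩⟩
  exact Module.Finite.of_exact
    ((ShortComplex.ShortExact.moduleCat_exact_iff_function_exact S).1 hS.exact)
    hS.moduleCat_surjective_g
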